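/- Let $1\le K\le N$, $\Delta\ge 0$ be integers and let $F$ be a field (for instance $GF(2^q)$). **Code.** In each timeslot $t\ge1$ a source vector $\mathbf s(t)\in F^K$ arrives and a packet $\mathbf x(t)=\sum_{v=\max(t-\alpha,1)}^{t}G_{t,v}\,\mathbf s(v)\in F^N$ is sent, where $\alpha\in\mathbb N\cup\{\infty\}$ is the memory length. The code is a realization of a *systematic random linear streaming code* (SRLSC): the first $K$ entries of $\mathbf x(t)$ are $\mathbf s(t)$, and in the last $N-K$ rows (parity rows) of $G_{t,v}$, $\max(t-\alpha,1)\le v\le t$, all entries are non-zero. Stacking the parity rows of timeslots $1,\dots,T$ (with zero blocks outside the window) gives the cumulative parity check matrix $P^{(T)}$, with columns indexed by the $KT$ entries of $\mathbf s(1),\dots,\mathbf s(T)$. The *generalized MDS condition* (GMDS) for $P^{(T)}$ says: whenever $(i_1,j_1),\dots,(i_L,j_L)$ are positions of non-zero entries of $P^{(T)}$ with pairwise distinct rows and pairwise distinct columns, the square submatrix with rows $i_1,\dots,i_L$ and columns $j_1,\dots,j_L$ is invertible. **Packet erasure channel and decodability.** In timeslot $t\ge 1$ the whole packet is erased ($e(t)=1$)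 or delivered ($e(t)=0$); put $e(0)=0$. Let $\mathbf H^{(T)}$ consist of the rows that express the entries of the delivered packets among $\mathbf x(1),\dots,\mathbf x(T)$ through $\mathbf s(1),\dots,\mathbf s(T)$. The vector $\mathbf s(t)$ is *$\Delta$-decodable* if for each of its $K$ entries the corresponding unit vector lies in the row space of $\mathbf H^{(t+\Delta)}$. **Information debt.** Let $I_d(0)=0$, $\zeta(0)=1$, $t_c=0$ and, for $t\ge1$, with $[x]^+=\max(x,0)$, $$\hat I_d(t)=\bigl[K-N(1-e(t))+\min(I_d(t-1),\zeta(t-1)-1)\bigr]^+,$$ $$\zeta(t)=\begin{cases}K e(t)-K e(\max(t-\alpha,t_c))+\zeta(t-1)&\text{if }\hat I_d(t)\ne0,\\ 1&\text{if }\hat I_d(t)=0,\end{cases}\qquad I_d(t)=\min(\zeta(t),\hat I_d(t)),$$ after which $t_c$ is replaced by $t$ if $I_d(t)=0$. Let $t_0=0$ and $t_{i}=\inf\{t'>t_{i-1}: I_d(t')=0\}$ for $i\ge 1$, with $\inf\emptyset=\infty$. **Statement ($\alpha\to\infty$).** For every timeslot $t\ge1$ there is an integer $A$ (depending only on $K,N,\Delta,t$)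 such that for every memory length $\alpha\ge A$, including $\alpha=\infty$, every field $F$, every SRLSC over $F$ with memory length $\alpha$ for which $P^{(t+\Delta)}$ satisfies GMDS, and every erasure pattern $e$: (a) for every $i_0\ge0$, if $t\in(t_{i_0},\,t_{i_0+1}-\Delta)$ and $e(t)=1$, then $\mathbf s(t)$ is not $\Delta$-decodable; (b) if there is no $i_0\ge 0$ with $t\in(t_{i_0},\,t_{i_0+1}-\Delta)$ and $e(t)=1$, then $\mathbf s(t)$ is $\Delta$-decodable. In particular, for $\alpha=\infty$ and GMDS for all $P^{(T)}$, (a) and (b) hold for all $t\ge 1$ simultaneously. -/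

import Mathlib

namespace StreamingCode

/-- A streaming code that maps `K` source symbols per timeslot to `N` encoded symbols.
`G u v` is the block of the generator matrix of timeslot `u` that multiplies `s(v)`, so that
`x(u) = ∑ v, G u v * s(v)`.  Timeslots are the natural numbers `≥ 1`. -/
abbrev Generator (F : Type*) (K N : ℕ) : Type _ :=
  ℕ → ℕ → Matrix (Fin N) (Fin K) F

/-- At timeslot `u` the encoder sees `s(v)` exactly for `max (u - α, 1) ≤ v ≤ u`.
The memory length `α` may be finite or infinite. -/
def InWindow (α : ℕ∞) (u v : ℕ) : Prop :=
  1 ≤ v ∧ v ≤ u ∧ (u : ℕ∞) ≤ (v : ℕ∞) + α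

/-- `G` is a realization of a systematic random linear streaming code with memory length `α`. -/
structure IsSystematic {F : Type*} [Field F] {K N : ℕ} (α : ℕ∞) (G : Generator F K N) :
    Prop where
  /-- Only the present symbols and those in the memory are encoded. -/
  eq_zero : ∀ u v, 1 ≤ u → ¬ InWindow α u v → G u v = 0
  /-- The first `K` symbols of `x(u)` are the uncoded symbols `s(u)`. -/
  systematic : ∀ u v, 1 ≤ u → InWindow α u v → ∀ (i : Fin N) (k : Fin K), (i : ℕ) < K →
    G u v i k = if u = v ∧ (i : ℕ) = (k : ℕ) then 1 else 0
  /-- The other `N - K` symbols (parity symbols) involve every symbol in the window. -/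
  parity_ne_zero : ∀ u v, 1 ≤ u → InWindow α u v → ∀ (i : Fin N) (k : Fin K), K ≤ (i : ℕ) →
    G u v i k ≠ 0

/-- The timeslots `1, …, T`. -/
abbrev Slot (T : ℕ) : Type := Set.Icc (1 : ℕ) T

/-- The cumulative parity check matrix up to timeslot `T`: the rows are the parity symbols of the
packets `x(1), …, x(T)`, the columns are the source symbols of `s(1), …, s(T)`. -/
def cumulativeParity {F : Type*} {K N : ℕ} (G : Generator F K N) (T : ℕ) :
    Matrix (Slot T × {i : Fin N // K ≤ (i : ℕ)}) (Slot T × Fin K) F :=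
  fun r c => G r.1 c.1 r.2 c.2

/-- The generalized MDS condition for a matrix: rows and columns that can be paired off along
nonzero entries induce an invertible square submatrix. -/
def GMDS {F R C : Type*} [Field F] (A : Matrix R C F) : Prop :=
  ∀ (L : ℕ) (i : Fin L → R) (j : Fin L → C), Function.Injective i → Function.Injective j →
    (∀ l, A (i l) (j l) ≠ 0) → IsUnit (A.submatrix i j)

/-- The cumulative receiver matrix up to timeslot `T` in the packet erasure channel with erasure
pattern `e` (`e t = true` iff the packet `x(t)` is erased): the rows are the symbols of the
packets among `x(1), …, x(T)` that are delivered. -/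
def cumulativeReceiver {F : Type*} {K N : ℕ} (G : Generator F K N) (e : ℕ → Bool) (T : ℕ) :
    Matrix ({u : Slot T // e u = false} × Fin N) (Slot T × Fin K) F :=
  fun r c => G r.1 c.1 r.2 c.2

/-- The symbol `s_k(t)` is `Δ`-decodable: its unit vector is in the row space of the cumulative
receiver matrix up to timeslot `t + Δ`. -/
def SymbolDecodable {F : Type*} [Field F] {K N : ℕ} (G : Generator F K N) (e : ℕ → Bool)
    (Δ t : ℕ) (k : Fin K) : Prop :=
  (fun c : Slot (t + Δ) × Fin K => if (c.1 : ℕ) = t ∧ c.2 = k then (1 : F) else 0) ∈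
    Submodule.span F (Set.range (cumulativeReceiver G e (t + Δ)).row)

/-- The vector `s(t)` is `Δ`-decodable. -/
def Decodable {F : Type*} [Field F] {K N : ℕ} (G : Generator F K N) (e : ℕ → Bool)
    (Δ t : ℕ) : Prop :=
  ∀ k : Fin K, SymbolDecodable G e Δ t k

/-- The indicator `e(t)` of an erasure, as an integer. -/
def erased (e : ℕ → Bool) (t : ℕ) : ℤ := if e t = true then 1 else 0

/-- The quantities that are updated in every timeslot: the information debt `I_d(t)`, its maximum
value `ζ(t)`, and the latest timeslot `t_c` at which the debt was zero. -/
structure DebtState where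
  debt : ℤ
  zeta : ℤ
  tc : ℕ

/-- One update, from timeslot `t - 1` to timeslot `t`.  Here `max (t - α, t_c)` is computed with
truncated subtraction, which changes nothing because `t_c ≥ 0`. -/
def DebtState.step (K N : ℕ) (α : ℕ∞) (e : ℕ → Bool) (t : ℕ) (s : DebtState) : DebtState :=
  let hatDebt : ℤ := max 0 ((K : ℤ) - (N : ℤ) * (1 - erased e t) + min s.debt (s.zeta - 1))
  let zeta : ℤ :=
    if hatDebt ≠ 0 then
      (K : ℤ) * erased e t - (K : ℤ) * erased e (max ((t : ℕ∞) - α).toNat s.tc) + s.zeta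
    else 1
  let debt : ℤ := min zeta hatDebt
  { debt := debt, zeta := zeta, tc := if debt = 0 then t else s.tc }

/-- The state of the information debt after timeslot `t`. -/
def debtState (K N : ℕ) (α : ℕ∞) (e : ℕ → Bool) : ℕ → DebtState
  | 0 => { debt := 0, zeta := 1, tc := 0 }
  | t + 1 => (debtState K N α e t).step K N α e (t + 1)

/-- The information debt `I_d(t)`. -/
def debt (K N : ℕ) (α : ℕ∞) (e : ℕ → Bool) (t : ℕ) : ℤ := (debtState K N α e t).debt

/-- The `i`-th time `t_i` at which the information debt is zero, with `t_0 = 0`; it is `∞` if there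
is no such time. -/
noncomputable def zeroTime (K N : ℕ) (α : ℕ∞) (e : ℕ → Bool) : ℕ → ℕ∞
  | 0 => 0
  | i + 1 => sInf {x : ℕ∞ | ∃ t' : ℕ, x = (t' : ℕ∞) ∧ zeroTime K N α e i < x ∧
      debt K N α e t' = 0}

end StreamingCode

namespace StreamingCode

/-! ### The information debt as a queue -/

/-! Once the memory reaches back to the first timeslot (`A = t + Δ` suffices), the cap `ζ` is
inactive and the debt is a queue length: an erased packet adds `K` unknowns, a delivered one brings
`N - K` parity equations. Counting and Hall's theorem produce matchings along causal pairs, whose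
entries are nonzero, and GMDS turns them into invertible matrices.

If the debt vanishes at some `u` in `[t, t + Δ]`, no interval ending at `u` has more unknowns than
equations. Hence all erased symbols up to `u` can be matched to parity rows that are not earlier,
and can be solved for (`unitVector_mem_span_of_debt_eq_zero`).

If instead the debt is zero at `τ < t` and positive on `(τ, t + Δ]`, every interval starting after
`τ` has strictly more unknowns than equations. Then the received parity rows can be matched to
erased symbols other than a chosen one, so the chosen symbol can be set to 1 and the others adjusted
to make every received row vanish: a functional that separates its unit vector from the row space
(`unitVector_notMem_span_of_debt_ne_zero`). -/

/-- Since `u ≤ α`, the lookback slot is `t_c`. It is never an erased slot, because an erasure makes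
the debt positive. So `ζ` only grows by arrivals until it is reset to 1, and it stays above the
debt; both minima in the update then drop out. -/
lemma debtState_invariant {K N : ℕ} (hKN : K ≤ N) {α : ℕ∞} {e : ℕ → Bool} (h0 : e 0 = false)
    (hK : 1 ≤ K) (u : ℕ) (hu : (u : ℕ∞) ≤ α) :
    0 ≤ (debtState K N α e u).debt ∧
      (debtState K N α e u).debt + 1 ≤ (debtState K N α e u).zeta ∧
      e (debtState K N α e u).tc = false ∧
      ∀ w, u = w + 1 → (debtState K N α e u).debt =
        max 0 ((debtState K N α e w).debt + (K - N * (1 - erased e u))) := by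
  induction u with
  | zero => simp [debtState, h0]
  | succ u ih =>
    obtain ⟨h1, h2, h3, -⟩ := ih (le_trans (by exact_mod_cast Nat.le_succ u) hu)
    have hsub : ((u + 1 : ℕ) : ℕ∞) - α = 0 := tsub_eq_zero_of_le hu
    simp only [debtState]
    generalize hs : debtState K N α e u = s at h1 h2 h3 ⊢
    have htc : erased e (max (((u + 1 : ℕ) : ℕ∞) - α).toNat s.tc) = 0 := by
      rw [hsub]
      simp [erased, h3]
    have hmin : min s.debt (s.zeta - 1) = s.debt := min_eq_left (by omega)
    have hKN' : (K : ℤ) ≤ N := by exact_mod_cast hKN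
    have hK' : (1 : ℤ) ≤ K := by exact_mod_cast hK
    simp only [DebtState.step, htc, hmin]
    rcases he : e (u + 1) with _ | _
    · have hE : erased e (u + 1) = 0 := by simp [erased, he]
      simp only [hE]
      refine ⟨?_, ?_, ?_, ?_⟩
      · split_ifs <;> omega
      · split_ifs <;> omega
      · split_ifs <;> simp [he, h3]
      · rintro w hw
        obtain rfl : u = w := by omega
        rw [hs]
        split_ifs <;> omega
    · have hE : erased e (u + 1) = 1 := by simp [erased, he]
      simp only [hE]
      refine ⟨?_, ?_, ?_, ?_⟩
      · split_ifs <;> omega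
      · split_ifs <;> omega
      · split_ifs <;> omega
      · rintro w hw
        obtain rfl : u = w := by omega
        rw [hs]
        split_ifs <;> omega

/-- As long as the memory reaches back to the first timeslot, the debt follows the Lindley
recursion of a queue. -/
lemma debt_succ {K N : ℕ} (hK : 1 ≤ K) (hKN : K ≤ N) {α : ℕ∞} {e : ℕ → Bool}
    (h0 : e 0 = false) (u : ℕ) (hu : ((u + 1 : ℕ) : ℕ∞) ≤ α) :
    debt K N α e (u + 1) =
      max 0 (debt K N α e u + (K - N * (1 - erased e (u + 1)))) :=
  (debtState_invariant hKN h0 hK (u + 1) hu).2.2.2 u rfl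

/-- The net number of unknowns that arrive in the timeslots `τ + 1, …, u`. -/
def netArrival (K N : ℕ) (e : ℕ → Bool) (τ u : ℕ) : ℤ :=
  ∑ w ∈ Finset.Ioc τ u, ((K : ℤ) - N * (1 - erased e w))

lemma netArrival_succ (K N : ℕ) (e : ℕ → Bool) {τ u : ℕ} (h : τ ≤ u) :
    netArrival K N e τ (u + 1) =
      netArrival K N e τ u + ((K : ℤ) - N * (1 - erased e (u + 1))) := by
  rw [netArrival, netArrival, Finset.sum_Ioc_succ_top h]

lemma netArrival_eq {K N : ℕ} (hKN : K ≤ N) (e : ℕ → Bool) (τ u : ℕ) :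
    netArrival K N e τ u = (({w ∈ Finset.Ioc τ u | e w = true}.card * K : ℕ) : ℤ) -
      (({w ∈ Finset.Ioc τ u | e w = false}.card * (N - K) : ℕ) : ℤ) := by
  have h : ∀ w, ((K : ℤ) - N * (1 - erased e w)) =
      (if e w = true then (K : ℤ) else 0) - (if e w = false then ((N - K : ℕ) : ℤ) else 0) := by
    intro w
    rcases he : e w with _ | _ <;> simp [erased, he]
    omega
  simp only [netArrival, h, Finset.sum_sub_distrib, ← Finset.sum_filter, Finset.sum_const,
    nsmul_eq_mul, Nat.cast_mul]

/-- Dropping the clipping at zero from the recursion can only lower the result. -/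
lemma netArrival_le_debt {K N : ℕ} (hK : 1 ≤ K) (hKN : K ≤ N) {α : ℕ∞} {e : ℕ → Bool}
    (h0 : e 0 = false) {τ u : ℕ} (hτ : τ ≤ u) (hu : (u : ℕ∞) ≤ α) :
    netArrival K N e τ u ≤ debt K N α e u := by
  induction u, hτ using Nat.le_induction with
  | base => simpa [netArrival, debt] using (debtState_invariant hKN h0 hK τ hu).1
  | succ u h ih =>
    have := ih (le_trans (by exact_mod_cast Nat.le_succ u) hu)
    rw [netArrival_succ K N e h, debt_succ hK hKN h0 u hu]
    exact le_max_of_le_right (by linarith)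

/-- While the debt is nonzero the clipping is never active, so the recursion telescopes. -/
lemma debt_eq_netArrival {K N : ℕ} (hK : 1 ≤ K) (hKN : K ≤ N) {α : ℕ∞} {e : ℕ → Bool}
    (h0 : e 0 = false) {τ u : ℕ} (hτ : τ ≤ u) (hu : (u : ℕ∞) ≤ α)
    (hz : debt K N α e τ = 0) (hpos : ∀ w, τ < w → w ≤ u → debt K N α e w ≠ 0) :
    debt K N α e u = netArrival K N e τ u := by
  induction u, hτ using Nat.le_induction with
  | base => simpa [netArrival] using hz
  | succ u h ih =>
    have h1 := ih (le_trans (by exact_mod_cast Nat.le_succ u) hu)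
      fun w hw hwu => hpos w hw (by omega)
    have h2 := hpos (u + 1) (by omega) le_rfl
    have h3 := debt_succ hK hKN h0 u hu
    rw [netArrival_succ K N e h, ← h1]
    omega

/-! ### The times of zero debt -/

lemma zeroTime_succ_le {K N : ℕ} {α : ℕ∞} {e : ℕ → Bool} {i u : ℕ}
    (h : zeroTime K N α e i < u) (hu : debt K N α e u = 0) :
    zeroTime K N α e (i + 1) ≤ u :=
  sInf_le ⟨u, rfl, h, hu⟩

lemma add_one_le_zeroTime_succ (K N : ℕ) (α : ℕ∞) (e : ℕ → Bool) (i : ℕ) :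
    zeroTime K N α e i + 1 ≤ zeroTime K N α e (i + 1) :=
  le_sInf fun _ ⟨_, _, hx, _⟩ => Order.add_one_le_of_lt hx

lemma le_zeroTime (K N : ℕ) (α : ℕ∞) (e : ℕ → Bool) (i : ℕ) :
    (i : ℕ∞) ≤ zeroTime K N α e i := by
  induction i with
  | zero => simp
  | succ i ih =>
    refine le_trans ?_ (add_one_le_zeroTime_succ K N α e i)
    push_cast
    gcongr

lemma debt_eq_zero_of_zeroTime_eq {K N : ℕ} {α : ℕ∞} {e : ℕ → Bool} {i u : ℕ}
    (h : zeroTime K N α e i = u) : debt K N α e u = 0 := by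
  cases i with
  | zero =>
    obtain rfl : u = 0 := by simpa [zeroTime, eq_comm] using h
    rfl
  | succ i =>
    -- An empty set would have infimum `⊤`; a nonempty one attains its infimum.
    have hne : {x : ℕ∞ | ∃ t' : ℕ, x = (t' : ℕ∞) ∧ zeroTime K N α e i < x ∧
        debt K N α e t' = 0}.Nonempty := by
      by_contra hne
      rw [Set.not_nonempty_iff_eq_empty] at hne
      rw [zeroTime, hne, sInf_empty] at h
      exact ENat.natCast_ne_top u h.symm
    obtain ⟨t', h1, -, h2⟩ := csInf_mem hne
    have : (t' : ℕ∞) = u := by rw [← h1, ← h, zeroTime]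
    obtain rfl : t' = u := by exact_mod_cast this
    exact h2

/-- A timeslot in the window before the next zero of the debt. -/
lemma exists_debt_eq_zero_of_mem_Ioo {K N : ℕ} {α : ℕ∞} {e : ℕ → Bool} {i t Δ : ℕ}
    (h : (t : ℕ∞) ∈ Set.Ioo (zeroTime K N α e i) (zeroTime K N α e (i + 1) - (Δ : ℕ∞))) :
    ∃ τ < t, debt K N α e τ = 0 ∧ ∀ u, τ < u → u ≤ t + Δ → debt K N α e u ≠ 0 := by
  obtain ⟨h1, h2⟩ := h
  obtain ⟨τ, hτ⟩ := ENat.ne_top_iff_exists.mp (ne_top_of_lt h1)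
  rw [← hτ] at h1
  refine ⟨τ, by exact_mod_cast h1, debt_eq_zero_of_zeroTime_eq hτ.symm, fun u hu hut hd => ?_⟩
  have h3 : zeroTime K N α e (i + 1) ≤ u :=
    zeroTime_succ_le (by rw [← hτ]; exact_mod_cast hu) hd
  have h4 := lt_tsub_iff_right.mp h2
  have h5 : ((t + Δ : ℕ) : ℕ∞) < u := by push_cast; exact h4.trans_le h3
  exact absurd (by exact_mod_cast h5 : t + Δ < u) (by omega)

/-- The index `i + 1` is the first whose zero time is at least `t`; it exists because the `j`-th
zero time is at least `j`. If that zero time were at most `t + Δ`, the debt would vanish there. -/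
lemma exists_mem_Ioo_of_debt_ne_zero {K N : ℕ} {α : ℕ∞} {e : ℕ → Bool} {t Δ : ℕ} (ht : 1 ≤ t)
    (h : ∀ u, t ≤ u → u ≤ t + Δ → debt K N α e u ≠ 0) :
    ∃ i, (t : ℕ∞) ∈ Set.Ioo (zeroTime K N α e i) (zeroTime K N α e (i + 1) - (Δ : ℕ∞)) := by
  classical
  have hex : ∃ j, (t : ℕ∞) ≤ zeroTime K N α e j := ⟨t, le_zeroTime K N α e t⟩
  obtain ⟨i, hi⟩ : ∃ i, Nat.find hex = i + 1 := by
    refine Nat.exists_eq_succ_of_ne_zero fun h0 => ?_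
    have := Nat.find_spec hex
    rw [h0, zeroTime] at this
    have : t ≤ 0 := by exact_mod_cast this
    omega
  have h1 := Nat.find_spec hex
  rw [hi] at h1
  refine ⟨i, not_le.mp (Nat.find_min hex (by omega)), lt_tsub_iff_right.mpr ?_⟩
  by_contra hlt
  rw [not_lt] at hlt
  have hlt' : zeroTime K N α e (i + 1) ≤ ((t + Δ : ℕ) : ℕ∞) := by exact_mod_cast hlt
  obtain ⟨u, hu⟩ := ENat.ne_top_iff_exists.mp (ne_top_of_le_ne_top (ENat.natCast_ne_top _) hlt')
  rw [← hu] at h1 hlt'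
  exact h u (by exact_mod_cast h1) (by exact_mod_cast hlt') (debt_eq_zero_of_zeroTime_eq hu.symm)

/-! ### Matchings -/

/-- Hall's condition for a staircase. -/
lemma exists_injective_of_card_filter_le {ι α β : Type*} [LinearOrder ι] [DecidableEq β]
    (R : Finset α) (C : Finset β) (ρ : α → ι) (γ : β → ι)
    (h : ∀ r ∈ R, {r' ∈ R | ρ r' ≤ ρ r}.card ≤ {c ∈ C | γ c ≤ ρ r}.card) :
    ∃ f : R → β, Function.Injective f ∧ ∀ r : R, f r ∈ C ∧ γ (f r) ≤ ρ r := by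
  classical
  suffices hall : ∀ S : Finset R, S.card ≤ (S.biUnion fun r => {c ∈ C | γ c ≤ ρ r}).card by
    obtain ⟨f, hf, hmem⟩ := (Finset.all_card_le_biUnion_card_iff_exists_injective _).mp hall
    exact ⟨f, hf, fun r => by simpa using hmem r⟩
  intro S
  rcases S.eq_empty_or_nonempty with rfl | hS
  · simp
  -- The neighbourhoods are nested, so Hall's condition for `S` need only be checked at its largest
  -- member.
  obtain ⟨m, hm, hmax⟩ := S.exists_max_image (fun r : R => ρ r) hS
  calc S.card = (S.map (Function.Embedding.subtype _)).card := (Finset.card_map _).symm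
    _ ≤ {r' ∈ R | ρ r' ≤ ρ m}.card := Finset.card_le_card fun x hx => by
        obtain ⟨y, hy, rfl⟩ := Finset.mem_map.mp hx
        exact Finset.mem_filter.mpr ⟨y.2, hmax y hy⟩
    _ ≤ {c ∈ C | γ c ≤ ρ m}.card := h m m.2
    _ ≤ _ := Finset.card_le_card
        (Finset.subset_biUnion_of_mem (fun r : R => {c ∈ C | γ c ≤ ρ r}) hm)

/-- The symbols, with indices in `κ`, of the timeslots in `τ + 1, …, u` with erasure indicator
`b`. -/
def symbols (κ : Type*) [Fintype κ] (e : ℕ → Bool) (b : Bool) (τ u : ℕ) : Finset (ℕ × κ) :=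
  {w ∈ Finset.Ioc τ u | e w = b} ×ˢ Finset.univ

lemma mem_symbols {κ : Type*} [Fintype κ] {e : ℕ → Bool} {b : Bool} {τ u : ℕ} {x : ℕ × κ} :
    x ∈ symbols κ e b τ u ↔ (τ < x.1 ∧ x.1 ≤ u) ∧ e x.1 = b := by
  simp [symbols]

lemma card_symbols (κ : Type*) [Fintype κ] (e : ℕ → Bool) (b : Bool) (τ u : ℕ) :
    (symbols κ e b τ u).card = {w ∈ Finset.Ioc τ u | e w = b}.card * Fintype.card κ := by
  simp [symbols]

lemma card_parity (K N : ℕ) : Fintype.card {i : Fin N // K ≤ (i : ℕ)} = N - K := by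
  rw [Fintype.card_subtype]
  rw [← Finset.card_map Fin.valEmbedding]
  rw [show ({i : Fin N | K ≤ (i : ℕ)} : Finset (Fin N)).map Fin.valEmbedding = Finset.Ico K N by
    ext x
    simp only [Finset.mem_map, Finset.mem_filter, Finset.mem_univ, true_and, Fin.valEmbedding_apply,
      Finset.mem_Ico]
    exact ⟨by rintro ⟨a, h, rfl⟩; exact ⟨h, a.2⟩, fun h => ⟨⟨x, h.2⟩, h.1, rfl⟩⟩]
  simp

/-- The bridge from the queue to Hall's condition: erased symbols minus received parity rows. -/
lemma netArrival_eq_card_sub_card {K N : ℕ} (hKN : K ≤ N) (e : ℕ → Bool) (τ u : ℕ) :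
    netArrival K N e τ u = ((symbols (Fin K) e true τ u).card : ℤ) -
      ((symbols {i : Fin N // K ≤ (i : ℕ)} e false τ u).card : ℤ) := by
  rw [netArrival_eq hKN, card_symbols, card_symbols, card_parity, Fintype.card_fin]

lemma filter_symbols_le {κ : Type*} [Fintype κ] (e : ℕ → Bool) (b : Bool) {τ u w : ℕ}
    (h : w ≤ u) :
    {x ∈ symbols κ e b τ u | x.1 ≤ w} = symbols κ e b τ w := by
  ext x
  simp only [Finset.mem_filter, mem_symbols]
  constructor
  · rintro ⟨⟨⟨h1, h2⟩, h3⟩, h4⟩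
    exact ⟨⟨h1, h4⟩, h3⟩
  · rintro ⟨⟨h1, h2⟩, h3⟩
    exact ⟨⟨⟨h1, by omega⟩, h3⟩, h2⟩

lemma filter_symbols_ge {κ : Type*} [Fintype κ] (e : ℕ → Bool) (b : Bool) {τ u w : ℕ}
    (h : τ ≤ w) :
    {x ∈ symbols κ e b τ u | w < x.1} = symbols κ e b w u := by
  ext x
  simp only [Finset.mem_filter, mem_symbols]
  constructor
  · rintro ⟨⟨⟨h1, h2⟩, h3⟩, h4⟩
    exact ⟨⟨h4, h2⟩, h3⟩
  · rintro ⟨⟨h1, h2⟩, h3⟩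
    exact ⟨⟨⟨by omega, h2⟩, h3⟩, h1⟩

/-! ### Decoding -/

section Decoding

variable {F : Type*} [Field F] {K N : ℕ} {α : ℕ∞} {G : Generator F K N}

lemma inWindow_of_le {T u v : ℕ} (hα : (T : ℕ∞) ≤ α) (hv : 1 ≤ v) (hvu : v ≤ u) (hu : u ≤ T) :
    InWindow α u v :=
  ⟨hv, hvu, le_add_left ((by exact_mod_cast hu : (u : ℕ∞) ≤ T).trans hα)⟩

lemma IsSystematic.apply_eq_zero_of_lt (hG : IsSystematic α G) {u v : ℕ} (hu : 1 ≤ u)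
    (huv : u < v) (i : Fin N) (k : Fin K) : G u v i k = 0 := by
  rw [hG.eq_zero u v hu fun h => absurd h.2.1 (by omega), Matrix.zero_apply]

lemma IsSystematic.apply_eq_ite (hG : IsSystematic α G) {u v : ℕ} (hu : 1 ≤ u)
    {i : Fin N} (hi : (i : ℕ) < K) (k : Fin K) :
    G u v i k = if u = v ∧ (i : ℕ) = (k : ℕ) then 1 else 0 := by
  by_cases h : InWindow α u v
  · exact hG.systematic u v hu h i k hi
  · rw [hG.eq_zero u v hu h, Matrix.zero_apply, if_neg]
    rintro ⟨rfl, -⟩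
    exact h ⟨hu, le_rfl, le_self_add⟩

/-- The generalized MDS condition for rows and columns that are paired off causally. -/
lemma GMDS.isUnit_of_causal {T : ℕ} (hA : GMDS (cumulativeParity G T)) (hG : IsSystematic α G)
    (hα : (T : ℕ∞) ≤ α) {ι : Type*} [Fintype ι] [DecidableEq ι]
    {i : ι → ℕ × {i : Fin N // K ≤ (i : ℕ)}} {j : ι → ℕ × Fin K} (hi : Function.Injective i)
    (hj : Function.Injective j)
    (h : ∀ l, 1 ≤ (j l).1 ∧ (j l).1 ≤ (i l).1 ∧ (i l).1 ≤ T) :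
    IsUnit (Matrix.of fun a b => G (i a).1 (j b).1 (i a).2 (j b).2) := by
  let σ := (Fintype.equivFin ι).symm
  let i' : ι → Slot T × {i : Fin N // K ≤ (i : ℕ)} :=
    fun l => (⟨(i l).1, (h l).1.trans (h l).2.1, (h l).2.2⟩, (i l).2)
  let j' : ι → Slot T × Fin K :=
    fun l => (⟨(j l).1, (h l).1, (h l).2.1.trans (h l).2.2⟩, (j l).2)
  have hi' : Function.Injective i' := fun a b hab => hi <| Prod.ext
    (congrArg (fun x => (x.1 : ℕ)) hab) (Prod.ext_iff.mp hab).2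
  have hj' : Function.Injective j' := fun a b hab => hj <| Prod.ext
    (congrArg (fun x => (x.1 : ℕ)) hab) (Prod.ext_iff.mp hab).2
  -- Because `T ≤ α`, every causal pair lies in the window, so its parity entry is nonzero.
  have key := hA _ (i' ∘ σ) (j' ∘ σ) (hi'.comp σ.injective) (hj'.comp σ.injective) fun l =>
    hG.parity_ne_zero _ _ ((h _).1.trans (h _).2.1)
      (inWindow_of_le hα (h _).1 (h _).2.1 (h _).2.2) _ _ (i (σ l)).2.2
  exact (Matrix.isUnit_submatrix_equiv
    (A := Matrix.of fun a b => G (i a).1 (j b).1 (i a).2 (j b).2) σ σ).mp key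

/-- The unit vector of a column. -/
abbrev unitVector (F : Type*) [Field F] {K T : ℕ} (c₀ : Slot T × Fin K) : Slot T × Fin K → F :=
  fun c => if (c.1 : ℕ) = c₀.1 ∧ c.2 = c₀.2 then (1 : F) else 0

lemma unitVector_eq_single {T : ℕ} (c₀ : Slot T × Fin K) :
    unitVector F c₀ = Pi.single c₀ 1 := by
  ext c
  simp only [unitVector, Pi.single_apply, Prod.ext_iff, Subtype.ext_iff]

/-- The symbols of a delivered packet are known. -/
lemma unitVector_mem_span_of_delivered (hKN : K ≤ N) (hG : IsSystematic α G) {e : ℕ → Bool}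
    {T : ℕ} (c₀ : Slot T × Fin K) (h : e c₀.1 = false) :
    unitVector F c₀ ∈ Submodule.span F (Set.range (cumulativeReceiver G e T).row) := by
  refine Submodule.subset_span ⟨(⟨c₀.1, h⟩, Fin.castLE hKN c₀.2), ?_⟩
  ext c
  simp only [Matrix.row, cumulativeReceiver, unitVector]
  rw [hG.apply_eq_ite c₀.1.2.1 (by simp)]
  simp only [Fin.val_castLE, Fin.ext_iff, eq_comm]

/-- When the debt is zero, everything that was sent so far is known. -/
lemma unitVector_mem_span_of_debt_eq_zero (hK : 1 ≤ K) (hKN : K ≤ N) (hG : IsSystematic α G)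
    {T : ℕ} (hα : (T : ℕ∞) ≤ α) (hA : GMDS (cumulativeParity G T)) {e : ℕ → Bool}
    (h0 : e 0 = false) {u : ℕ} (hu : u ≤ T) (hd : debt K N α e u = 0) (c₀ : Slot T × Fin K)
    (hc₀ : (c₀.1 : ℕ) ≤ u) :
    unitVector F c₀ ∈ Submodule.span F (Set.range (cumulativeReceiver G e T).row) := by
  classical
  rcases he₀ : e c₀.1 with _ | _
  · exact unitVector_mem_span_of_delivered hKN hG c₀ he₀
  -- The order is reversed because each unknown needs a parity row that is not earlier than itself.
  obtain ⟨g, hg, hgC⟩ := exists_injective_of_card_filter_le (ι := ℕᵒᵈ)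
    (symbols (Fin K) e true 0 u) (symbols {i : Fin N // K ≤ (i : ℕ)} e false 0 u)
    (fun c => OrderDual.toDual c.1) (fun r => OrderDual.toDual r.1) (by
      intro c hc
      obtain ⟨⟨h1, h2⟩, -⟩ := mem_symbols.mp hc
      have h3 := netArrival_le_debt hK hKN h0 (τ := c.1 - 1) (u := u) (by omega)
        ((by exact_mod_cast hu : (u : ℕ∞) ≤ T).trans hα)
      rw [hd, netArrival_eq_card_sub_card hKN] at h3
      simp only [OrderDual.toDual_le_toDual]
      -- The interval must include the slot `c.1`, and `Ioc` omits its left end; `c.1 ≥ 1` makes the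
      -- subtraction exact.
      have h4 : ∀ x, c.1 ≤ x ↔ c.1 - 1 < x := by omega
      simp only [h4]
      rw [filter_symbols_ge _ _ (Nat.zero_le _), filter_symbols_ge _ _ (Nat.zero_le _)]
      omega)
  simp only [OrderDual.toDual_le_toDual, mem_symbols] at hgC
  have hmem : ∀ c : symbols (Fin K) e true 0 u, (0 < c.1.1 ∧ c.1.1 ≤ u) ∧ e c.1.1 = true :=
    fun c => mem_symbols.mp c.2
  have hunit := hA.isUnit_of_causal hG hα hg Subtype.val_injective fun c =>
    ⟨(hmem c).1.1, (hgC c).2, (hgC c).1.1.2.trans hu⟩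
  set M : Matrix (symbols (Fin K) e true 0 u) (symbols (Fin K) e true 0 u) F :=
    Matrix.of fun a b => G (g a).1 b.1.1 (g a).2 b.1.2 with hM
  let d₀ : symbols (Fin K) e true 0 u := ⟨(c₀.1, c₀.2), mem_symbols.mpr ⟨⟨c₀.1.2.1, hc₀⟩, he₀⟩⟩
  obtain ⟨y, hy⟩ := Matrix.vecMul_surjective_iff_isUnit.mpr hunit (Pi.single d₀ 1)
  let row : symbols (Fin K) e true 0 u → Slot T × Fin K → F := fun a =>
    (cumulativeReceiver G e T).row
      (⟨⟨(g a).1, (hgC a).1.1.1, (hgC a).1.1.2.trans hu⟩, (hgC a).1.2⟩, (g a).2)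
  let z : Slot T × Fin K → F := ∑ a, y a • row a
  have hz : z ∈ Submodule.span F (Set.range (cumulativeReceiver G e T).row) :=
    Submodule.sum_mem _ fun a _ => Submodule.smul_mem _ _ (Submodule.subset_span ⟨_, rfl⟩)
  have hzapply : ∀ c, z c = ∑ a, y a * G (g a).1 c.1 (g a).2 c.2 := fun c => by
    simp [z, row, Matrix.row, cumulativeReceiver]
  -- On erased columns `z` already agrees with the unit vector: by the choice of `y` up to `u`, by
  -- causality after `u`. Its entries on delivered columns are removed with known unit vectors.
  have heq : unitVector F c₀ =
      z - ∑ c : Slot T × Fin K, if e c.1 = false then z c • unitVector F c else 0 := by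
    ext c
    have hsum : (∑ c' : Slot T × Fin K, if e c'.1 = false then z c' • unitVector F c' else 0) c =
        if e c.1 = false then z c else 0 := by
      rw [Finset.sum_apply, Finset.sum_eq_single c]
      · split_ifs <;> simp
      · intro b _ hb
        rw [unitVector_eq_single]
        split_ifs <;> simp [hb.symm]
      · simp
    rw [Pi.sub_apply, hsum]
    rcases he : e c.1 with _ | _
    · have : c ≠ c₀ := fun h => by rw [h, he₀] at he; cases he
      rw [unitVector_eq_single]
      simp [this]
    · simp only [Bool.true_eq_false, if_false, sub_zero]
      by_cases hcu : (c.1 : ℕ) ≤ u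
      · have h1 := congrFun hy ⟨(c.1, c.2), mem_symbols.mpr ⟨⟨c.1.2.1, hcu⟩, he⟩⟩
        simp only [Matrix.vecMul, dotProduct, hM, Matrix.of_apply] at h1
        rw [hzapply, h1]
        simp [Pi.single_apply, d₀, Prod.ext_iff]
      · rw [hzapply, Finset.sum_eq_zero, unitVector, if_neg]
        · rintro ⟨h, -⟩
          omega
        · intro a _
          have := (hgC a).1.1
          rw [hG.apply_eq_zero_of_lt this.1 (by omega), mul_zero]
  rw [heq]
  refine Submodule.sub_mem _ hz (Submodule.sum_mem _ fun c _ => ?_)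
  split_ifs with h
  · exact Submodule.smul_mem _ _ (unitVector_mem_span_of_delivered hKN hG c h)
  · exact Submodule.zero_mem _

/-- An erased symbol is unknown as long as the debt does not return to zero. -/
lemma unitVector_notMem_span_of_debt_ne_zero (hK : 1 ≤ K) (hKN : K ≤ N) (hG : IsSystematic α G)
    {T : ℕ} (hα : (T : ℕ∞) ≤ α) (hA : GMDS (cumulativeParity G T)) {e : ℕ → Bool}
    (h0 : e 0 = false) {τ : ℕ} (hd : debt K N α e τ = 0) (c₀ : Slot T × Fin K) (hτ : τ < c₀.1)
    (hpos : ∀ u, τ < u → u ≤ T → debt K N α e u ≠ 0) (he₀ : e c₀.1 = true) :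
    unitVector F c₀ ∉ Submodule.span F (Set.range (cumulativeReceiver G e T).row) := by
  classical
  have hmem₀ : ((c₀.1 : ℕ), c₀.2) ∈ symbols (Fin K) e true τ T :=
    mem_symbols.mpr ⟨⟨hτ, c₀.1.2.2⟩, he₀⟩
  obtain ⟨f, hf, hfC⟩ := exists_injective_of_card_filter_le
    (symbols {i : Fin N // K ≤ (i : ℕ)} e false τ T)
    ((symbols (Fin K) e true τ T).erase (c₀.1, c₀.2))
    (fun r => r.1) (fun c => c.1) (by
      intro r hr
      obtain ⟨⟨h1, h2⟩, -⟩ := mem_symbols.mp hr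
      have hrα : (r.1 : ℕ∞) ≤ α := (by exact_mod_cast h2 : (r.1 : ℕ∞) ≤ T).trans hα
      have h3 := debt_eq_netArrival hK hKN h0 h1.le hrα hd fun w hw hwr => hpos w hw (by omega)
      have h4 := hpos r.1 h1 h2
      have h5 : 0 ≤ debt K N α e r.1 := (debtState_invariant hKN h0 hK r.1 hrα).1
      rw [netArrival_eq_card_sub_card hKN] at h3
      rw [Finset.filter_erase, filter_symbols_le _ _ h2, filter_symbols_le _ _ h2]
      -- Positive integer debt leaves a surplus of at least one unknown, which pays for the erased
      -- element `c₀`.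
      have h6 := Finset.pred_card_le_card_erase (s := symbols (Fin K) e true τ r.1)
        (a := ((c₀.1 : ℕ), c₀.2))
      omega)
  simp only [Finset.mem_erase, mem_symbols] at hfC
  have hmem : ∀ r : symbols {i : Fin N // K ≤ (i : ℕ)} e false τ T,
      (τ < r.1.1 ∧ r.1.1 ≤ T) ∧ e r.1.1 = false := fun r => mem_symbols.mp r.2
  have hunit := hA.isUnit_of_causal hG hα Subtype.val_injective hf fun r =>
    ⟨by have := (hfC r).1.2.1.1; omega, (hfC r).2, (hmem r).1.2⟩
  obtain ⟨y, hy⟩ := Matrix.mulVec_surjective_iff_isUnit.mpr hunit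
    fun r => -G r.1.1 c₀.1 r.1.2 c₀.2
  let f' : symbols {i : Fin N // K ≤ (i : ℕ)} e false τ T → Slot T × Fin K := fun r =>
    (⟨(f r).1, by have := (hfC r).1.2.1.1; omega, (hfC r).1.2.1.2⟩, (f r).2)
  -- Evaluation at a candidate source: 1 at `c₀`, `y` on the matched symbols, 0 elsewhere. Its
  -- support consists of erased symbols after `τ`, so systematic rows of delivered packets and all
  -- rows up to `τ` vanish on it; `y` was chosen to kill the later parity rows.
  let φ : (Slot T × Fin K → F) →ₗ[F] F :=
    LinearMap.proj c₀ + ∑ r, y r • LinearMap.proj (f' r)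
  have hφ : ∀ z, φ z = z c₀ + ∑ r, y r * z (f' r) := fun z => by simp [φ]
  have hrow : Submodule.span F (Set.range (cumulativeReceiver G e T).row) ≤ LinearMap.ker φ := by
    rw [Submodule.span_le]
    rintro _ ⟨⟨⟨w, hw⟩, i⟩, rfl⟩
    rw [SetLike.mem_coe, LinearMap.mem_ker, hφ]
    simp only [Matrix.row, cumulativeReceiver]
    by_cases hi : (i : ℕ) < K
    · have hne : ∀ v, e v = true → (w : ℕ) ≠ v := by
        rintro v hv rfl
        rw [hw] at hv
        cases hv
      rw [hG.apply_eq_ite w.2.1 hi, if_neg fun h => hne _ he₀ h.1, Finset.sum_eq_zero, add_zero]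
      intro r _
      rw [hG.apply_eq_ite w.2.1 hi, if_neg fun h => hne _ (hfC r).1.2.2 h.1, mul_zero]
    · by_cases hwτ : τ < w
      · have h1 := congrFun hy ⟨(w, ⟨i, by omega⟩), mem_symbols.mpr ⟨⟨hwτ, w.2.2⟩, hw⟩⟩
        simp only [Matrix.mulVec, dotProduct, Matrix.of_apply] at h1
        rw [add_eq_zero_iff_neg_eq, ← h1]
        exact Finset.sum_congr rfl fun r _ => mul_comm _ _
      · rw [hG.apply_eq_zero_of_lt w.2.1 (by omega), Finset.sum_eq_zero, add_zero]
        intro r _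
        have h2 : τ < ((f' r).1 : ℕ) := (hfC r).1.2.1.1
        rw [hG.apply_eq_zero_of_lt w.2.1 (by omega), mul_zero]
  intro hspan
  have h1 := LinearMap.mem_ker.mp (hrow hspan)
  rw [hφ, Finset.sum_eq_zero, add_zero] at h1
  · simp [unitVector] at h1
  · intro r _
    rw [unitVector, if_neg, mul_zero]
    rintro ⟨h2, h3⟩
    exact (hfC r).1.1 (Prod.ext h2 h3)

end Decoding

end StreamingCode

theorem mainTheorem10 (K N Δ : ℕ) (hK : 1 ≤ K) (hKN : K ≤ N) (t : ℕ) (ht : 1 ≤ t) :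
    ∃ A : ℕ, ∀ α : ℕ∞, (A : ℕ∞) ≤ α →
      ∀ (F : Type*) [Field F] (G : StreamingCode.Generator F K N),
        StreamingCode.IsSystematic α G →
        StreamingCode.GMDS (StreamingCode.cumulativeParity G (t + Δ)) →
        ∀ e : ℕ → Bool, e 0 = false →
          (∀ i₀ : ℕ,
            (t : ℕ∞) ∈ Set.Ioo (StreamingCode.zeroTime K N α e i₀)
              (StreamingCode.zeroTime K N α e (i₀ + 1) - (Δ : ℕ∞)) →
            e t = true → ¬ StreamingCode.Decodable G e Δ t) ∧
          ((¬ ∃ i₀ : ℕ,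
            (t : ℕ∞) ∈ Set.Ioo (StreamingCode.zeroTime K N α e i₀)
              (StreamingCode.zeroTime K N α e (i₀ + 1) - (Δ : ℕ∞)) ∧
            e t = true) → StreamingCode.Decodable G e Δ t) := by
  refine ⟨t + Δ, fun α hα F _ G hG hA e h0 => ⟨fun i₀ hi₀ het hdec => ?_, fun hno k => ?_⟩⟩
  · obtain ⟨τ, hτ, hd, hpos⟩ := StreamingCode.exists_debt_eq_zero_of_mem_Ioo hi₀
    -- No entry of `s(t)` is recoverable; entry 0 exists because `1 ≤ K`.
    exact StreamingCode.unitVector_notMem_span_of_debt_ne_zero hK hKN hG hα hA h0 hd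
      (⟨t, ht, by omega⟩, ⟨0, hK⟩) hτ hpos het (hdec ⟨0, hK⟩)
  · rcases he : e t with _ | _
    · exact StreamingCode.unitVector_mem_span_of_delivered hKN hG
        (⟨t, ht, by omega⟩, k) he
    · obtain ⟨u, htu, hut, hd⟩ : ∃ u, t ≤ u ∧ u ≤ t + Δ ∧ StreamingCode.debt K N α e u = 0 := by
        by_contra! h
        obtain ⟨i, hi⟩ := StreamingCode.exists_mem_Ioo_of_debt_ne_zero ht h
        exact hno ⟨i, hi, he⟩
      exact StreamingCode.unitVector_mem_span_of_debt_eq_zero hK hKN hG hα hA h0 hut hd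
        (⟨t, ht, by omega⟩, k) htu
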